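/- Let $\mathcal X$ be a countable state space, let $\Delta(\mathcal X)$ be the set of probability distributions over $\mathcal X$, and let $\ell\colon\Delta(\mathcal X)\times\mathcal X\to[a,b]\subset\mathbb R$ be a bounded scoring rule and $\delta\in(0,1)$. An environment $f^\star\colon\mathcal X^*\to\Delta(\mathcal X)$ generates a process $X_1,X_2,\dots$ by $X_t\sim Y^\star_t:=f^\star(X_1,\dots,X_{t-1})$, and a model $\hat f\colon\mathcal X^*\to\Delta(\mathcal X)$ predicts $\hat Y_t:=\hat f(X_1,\dots,X_{t-1})$. Put $V_t=(\hat Y_t,Y^\star_t)$ (hidden), $W_t=(\hat Y_t,X_t)$ (observed), and let the average expected score be $$E^\ell(V_1,\dots,V_t)=\frac1t\sum_{i=1}^t\mathbb E_{x\sim Y_i^\star}\,\ell(\hat Y_i,x).$$ For $n\ge 1$, $t\ge1$ and $\sigma\ge0$ let $$g(n,\delta)=2\log\Big(\frac{\pi\log(e\,n)}{\sqrt6}\Big)+\log\frac2\delta,\qquad \varepsilon_t(n,\delta,\sigma)=\frac{\sqrt{2.13\,n\,g(n,\delta)+1.76\,\sigma^2g(n,\delta)^2}+1.33\,\sigma\,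 g(n,\delta)}{t}.$$ The average alignment monitor $M_{\ell,\delta}$ starts with $t=0$, $\hat E=0$, $N=1$, $\sigma=b-a$; on every new observation $(\hat y,x)$ it computes, in this order, $$s\leftarrow\ell(\hat y,x),\quad t\leftarrow t+1,\quad N\leftarrow\max\big(1,N+(s-\hat E)^2\big),\quad \hat E\leftarrow\tfrac1t\big((t-1)\hat E+s\big),$$ and outputs the interval $[\hat E-\varepsilon_t(N,\delta,\sigma),\ \hat E+\varepsilon_t(N,\delta,\sigma)]$. Then: 1. For every environment $f^\star$ and every model $\hat f$, $$\mathbb P_{f^\star}\big(\forall t\ge1:\ E^\ell(V_1,\dots,V_t)\in M_{\ell,\delta}(W_1,\dots,W_t)\big)\ge1-\delta.$$ 2. The same holds when the output at time $t$ is replaced by $[\hat E_t-\varepsilon_t(N_t,\delta,b-a),\ \hat E_t+\varepsilon_t(N_t,\delta,b-a)]$, where $\hat E_t=\frac1t\sum_{i=1}^t\ell(\hat Y_i,X_i)$, $\hat E_0=0$ and $N_t=\max\big(1,\sum_{i=1}^t(\ell(\hat Y_i,X_i)-\hat E_{i-1})^2\big)$. 3. On a random access machine over the reals (arithmetic, $\max$,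 $\sqrt{\cdot}$, $\log$, memory access and comparison jumps at unit cost; evaluating $\ell$ on the current input $(\hat y,x)$ at cost $T_{\ell,\mathcal X}(\hat y,x)\ge1$), the monitor is implemented by a program each update of which takes time $O(T_{\ell,\mathcal X})$ and which uses $O(1)$ registers in total, apart from the input and the working memory of the evaluation of $\ell$. The program and the constants are absolute: they depend neither on the history nor on $\mathcal X$, $\ell$, $a$, $b$, $\delta$. -/

import Mathlib

open MeasureTheory ProbabilityTheory

noncomputable section

namespace AlignmentMonitoring

/-! ## Environment, model, hidden and observed process

The state space `X` is countable and carries its discrete σ-algebra; `PMF X` is the set of all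
probability distributions over `X`.  Environments and models are arbitrary functions
`List X → PMF X`.  The trajectory `X_1, X_2, …` is written `x 0, x 1, …`. -/

section Processes

variable {X : Type*}

/-- The first `t` states `X_1, …, X_t` of a trajectory. -/
def history (x : ℕ → X) (t : ℕ) : List X :=
  List.ofFn fun i : Fin t => x i

/-- The hidden history `V_1, …, V_t`, where `V_i` consists of the prediction
`model (X_1, …, X_{i-1})` and the true distribution `env (X_1, …, X_{i-1})`. -/
def hidden (model env : List X → PMF X) (x : ℕ → X) (t : ℕ) : List (PMF X × PMF X) :=
  List.ofFn fun i : Fin t => (model (history x i), env (history x i))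

/-- The observed history `W_1, …, W_t`, where `W_i` consists of the prediction
`model (X_1, …, X_{i-1})` and the observed state `X_i`. -/
def observed (model : List X → PMF X) (x : ℕ → X) (t : ℕ) : List (PMF X × X) :=
  List.ofFn fun i : Fin t => (model (history x i), x i)

variable [MeasurableSpace X] [DiscreteMeasurableSpace X] [Countable X]

/-- The transition kernel of the environment: given the first `n + 1` states, the next state is
sampled from `env` applied to them. -/
def envKernel (env : List X → PMF X) (n : ℕ) :
    Kernel ((i : Finset.Iic n) → (fun _ : ℕ => X) i) X where
  toFun h := (env (List.ofFn fun i : Fin (n + 1) =>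
    h ⟨i, Finset.mem_Iic.2 (Nat.lt_succ_iff.1 i.2)⟩)).toMeasure
  measurable' := measurable_of_countable _

instance (env : List X → PMF X) (n : ℕ) : IsMarkovKernel (envKernel env n) :=
  ⟨fun _ => inferInstanceAs (IsProbabilityMeasure (PMF.toMeasure _))⟩

/-- The law of the trajectory `(X_t)_t` generated by the environment: `X_1 ∼ env []` and
`X_{t+1} ∼ env [X_1, …, X_t]` given the past. -/
def envMeasure (env : List X → PMF X) : Measure (ℕ → X) :=
  Kernel.trajMeasure (X := fun _ => X) (env []).toMeasure (envKernel env)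

/-- The monitor `M`, which maps an observed history to the end points of an interval, is correct
for the alignment score `d` with error probability `δ`: for every environment and every model,
with probability at least `1 - δ`, at all times the score of the hidden history lies in the
interval computed from the observed history. -/
def SolvesAlignmentProblem (d : List (PMF X × PMF X) → ℝ) (M : List (PMF X × X) → ℝ × ℝ)
    (δ : ℝ) : Prop :=
  ∀ env model : List X → PMF X,
    ENNReal.ofReal (1 - δ) ≤ envMeasure env
      {x | ∀ t : ℕ, 1 ≤ t →
        d (hidden model env x t) ∈
          Set.Icc (M (observed model x t)).1 (M (observed model x t)).2}

/-- The average expected score of a hidden history. -/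
def averageExpectedScore (ℓ : PMF X → X → ℝ) (v : List (PMF X × PMF X)) : ℝ :=
  (v.map fun p => ∫ x, ℓ p.1 x ∂p.2.toMeasure).sum / v.length

end Processes

/-! ## The average alignment monitor -/

section Monitor

variable {X : Type*}

/-- The iterated-logarithm term of the stitched bound (epochs growing geometrically by the
factor `e`, starting at intrinsic time `1`, each side receiving half of the error). -/
def stitch (n δ : ℝ) : ℝ :=
  2 * Real.log (Real.pi * Real.log (Real.exp 1 * n) / √6) + Real.log (2 / δ)

/-- The half-width `ε_t(n, δ, σ)`. -/
def halfWidth (t n δ σ : ℝ) : ℝ :=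
  (√(2.13 * n * stitch n δ + 1.76 * σ ^ 2 * stitch n δ ^ 2) + 1.33 * σ * stitch n δ) / t

/-- The average score of an observed history (`0` for the empty history). -/
def averageScore (ℓ : PMF X → X → ℝ) (w : List (PMF X × X)) : ℝ :=
  (w.map fun p => ℓ p.1 p.2).sum / w.length

/-- The empirical variance process: the sum over `i` of the squared difference between the
`i`-th score and the average of the previous scores. -/
def empiricalVariance (ℓ : PMF X → X → ℝ) (w : List (PMF X × X)) : ℝ :=
  ∑ i : Fin w.length, (ℓ w[i].1 w[i].2 - averageScore ℓ (w.take i)) ^ 2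

/-- The confidence interval in closed form: average score plus/minus
`ε_t(max (1, empirical variance), δ, b - a)`. -/
def confidenceInterval (ℓ : PMF X → X → ℝ) (a b δ : ℝ) (w : List (PMF X × X)) : ℝ × ℝ :=
  (averageScore ℓ w - halfWidth w.length (max 1 (empiricalVariance ℓ w)) δ (b - a),
    averageScore ℓ w + halfWidth w.length (max 1 (empiricalVariance ℓ w)) δ (b - a))

/-- The counters of the algorithm. -/
structure Counters where
  /-- the time -/
  t : ℕ
  /-- the average score -/
  E : ℝ
  /-- the variance -/
  N : ℝ

/-- Initial values of the counters. -/
def initCounters : Counters := ⟨0, 0, 1⟩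

/-- One update of the counters, on the prediction and the state `p = (ŷ, x)`. -/
def nextCounters (ℓ : PMF X → X → ℝ) (c : Counters) (p : PMF X × X) : Counters :=
  let s := ℓ p.1 p.2
  let t := c.t + 1
  let N := max 1 (c.N + (s - c.E) ^ 2)
  let E := 1 / (t : ℝ) * (((t : ℝ) - 1) * c.E + s)
  ⟨t, E, N⟩

/-- The average alignment monitor: run the algorithm on the observed history and return the
last interval. -/
def alignmentMonitor (ℓ : PMF X → X → ℝ) (a b δ : ℝ) (w : List (PMF X × X)) : ℝ × ℝ :=
  let c := w.foldl (nextCounters ℓ) initCounters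
  (c.E - halfWidth c.t c.N δ (b - a), c.E + halfWidth c.t c.N δ (b - a))

end Monitor

/-! ## A real random access machine with costs

Registers are indexed by `ℕ` and hold real numbers.  Arithmetic, `max`, square root, logarithm,
indirect addressing and comparison jumps cost one time unit each.  The instruction `score`
evaluates the scoring rule on the current input `(ŷ, x)` and costs the time `τ` that this
evaluation takes. -/

/-- Instructions; `d` is always the destination register. -/
inductive Instr where
  | const (d : ℕ) (c : ℝ)
  | add (d i j : ℕ)
  | sub (d i j : ℕ)
  | mul (d i j : ℕ)
  | div (d i j : ℕ)
  | max (d i j : ℕ)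
  | sqrt (d i : ℕ)
  | log (d i : ℕ)
  /-- write into register `d` the content of the register whose number is in register `i` -/
  | load (d i : ℕ)
  /-- write the content of register `i` into the register whose number is in register `d` -/
  | store (d i : ℕ)
  /-- if register `i` is at most register `j`, continue at instruction `n` -/
  | jumpLe (i j n : ℕ)
  /-- write the score of the current input into register `d` -/
  | score (d : ℕ)

/-- Configurations: program counter, registers, time consumed, set of registers accessed. -/
structure Config where
  pc : ℕ
  mem : ℕ → ℝ
  time : ℕ
  used : Finset ℕ

/-- Write `v` into register `d` and go to the next instruction, at the given cost, having accessed
`d` and the registers in `r`. -/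
def Config.write (c : Config) (d : ℕ) (v : ℝ) (cost : ℕ) (r : Finset ℕ) : Config :=
  ⟨c.pc + 1, Function.update c.mem d v, c.time + cost, c.used ∪ insert d r⟩

/-- Execution of one instruction; `s` is the score of the current input and `τ` the time needed to
evaluate it. -/
def Instr.exec (s : ℝ) (τ : ℕ) (c : Config) : Instr → Config
  | .const d v => c.write d v 1 ∅
  | .add d i j => c.write d (c.mem i + c.mem j) 1 {i, j}
  | .sub d i j => c.write d (c.mem i - c.mem j) 1 {i, j}
  | .mul d i j => c.write d (c.mem i * c.mem j) 1 {i, j}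
  | .div d i j => c.write d (c.mem i / c.mem j) 1 {i, j}
  | .max d i j => c.write d (Max.max (c.mem i) (c.mem j)) 1 {i, j}
  | .sqrt d i => c.write d (√(c.mem i)) 1 {i}
  | .log d i => c.write d (Real.log (c.mem i)) 1 {i}
  | .load d i => c.write d (c.mem ⌊c.mem i⌋₊) 1 {i, ⌊c.mem i⌋₊}
  | .store d i => c.write ⌊c.mem d⌋₊ (c.mem i) 1 {d, i}
  | .jumpLe i j n =>
      ⟨open Classical in if c.mem i ≤ c.mem j then n else c.pc + 1,
        c.mem, c.time + 1, c.used ∪ {i, j}⟩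
  | .score d => c.write d s τ ∅

/-- One step of a program; a configuration whose program counter has left the program is final. -/
def step (prog : List Instr) (s : ℝ) (τ : ℕ) (c : Config) : Config :=
  match prog[c.pc]? with
  | some i => i.exec s τ c
  | none => c

/-- Started at its first instruction on the registers `m`, the program halts with registers `m'`,
having consumed the time `time` and accessed exactly the registers in `used`. -/
def HaltsWith (prog : List Instr) (s : ℝ) (τ : ℕ) (m m' : ℕ → ℝ) (time : ℕ)
    (used : Finset ℕ) : Prop :=
  ∃ n pc : ℕ, prog.length ≤ pc ∧ (step prog s τ)^[n] ⟨0, m, 0, ∅⟩ = ⟨pc, m', time, used⟩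

/-- The registers after initialisation: `t = 0`, `Ê = 0`, `N = 1`, `σ = b - a` and `δ` in the
registers `0, 1, 2, 3, 4`; all other registers are `0`. -/
def initRegisters (a b δ : ℝ) : ℕ → ℝ
  | 2 => 1
  | 3 => b - a
  | 4 => δ
  | _ => 0

/-- The program `prog`, executed once per input on the registers left by the previous execution,
implements the average alignment monitor on every input sequence `w 0, w 1, …`: after each
execution, the registers `0, 1, 2` hold the counters and the registers `5, 6` hold the end points
of the interval.  Each execution takes time at most `K` times the time `τ` that is needed to
evaluate the scoring rule on the current input, and only the first `K` registers are ever
accessed. -/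
def ImplementsMonitor {X : Type*} (prog : List Instr) (K : ℕ) (ℓ : PMF X → X → ℝ) (a b δ : ℝ)
    (τ : PMF X → X → ℕ) : Prop :=
  ∀ w : ℕ → PMF X × X, ∃ m : ℕ → ℕ → ℝ, m 0 = initRegisters a b δ ∧
    ∀ k : ℕ,
      (∃ (time : ℕ) (used : Finset ℕ),
        HaltsWith prog (ℓ (w k).1 (w k).2) (τ (w k).1 (w k).2) (m k) (m (k + 1)) time used ∧
        time ≤ K * τ (w k).1 (w k).2 ∧ used ⊆ Finset.range K) ∧
      (let h : List (PMF X × X) := List.ofFn fun i : Fin (k + 1) => w i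
       let c := h.foldl (nextCounters ℓ) initCounters
       m (k + 1) 0 = c.t ∧ m (k + 1) 1 = c.E ∧ m (k + 1) 2 = c.N ∧
       m (k + 1) 5 = (alignmentMonitor ℓ a b δ h).1 ∧
       m (k + 1) 6 = (alignmentMonitor ℓ a b δ h).2)

end AlignmentMonitoring

end

/-!
# Correctness and cost of the average alignment monitor

The error of the monitor at time `t` is `S t / t`, where `S t` is the sum of the centred scores
`ℓ(Ŷ_i, X_i) - E ℓ(Ŷ_i, ·)`. Let `V t` be the empirical variance, the sum of the squares
`(ℓ(Ŷ_i, X_i) - Ê_{i-1})²`, and `c = b - a`. For `0 ≤ r` with `c r < 1`, the process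
`exp (r S t - r² / (2 (1 - c r)) V t)` is a nonnegative supermartingale (`lintegral_exp_le_one`);
this rests on `exp (z - z² / (2 (1 - q))) ≤ 1 + z` for `z ≥ -q`. The inequality needs the predicted
value to lie in `[a, b]`. The initial value `Ê_0 = 0` need not do so, but projecting a prediction
to `[a, b]` only decreases the squared error. As all processes are functions of the history,
supermartingales are functions on lists, and Ville's inequality `envMeasure_exists_le` bounds the
probability that such a process ever exceeds a level.

Each `r` gives a bound on `S` that is affine in `V`. The range `[1, ∞)` of the intrinsic time
`max 1 V` is cut into the epochs `[e ^ k, e ^ (k + 1))`; with the parameter `slope` adapted to the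
`k`-th epoch, the affine bound lies below the curve of the monitor there (`lt_curve`). The error
probabilities `exp (-stitch (e ^ k) δ)` of the epochs add up to `δ / 2` because
`∑ 1 / (k + 1) ^ 2 = π ^ 2 / 6`. Applying this to the scores and to their negatives gives the
two-sided bound `le_envMeasure_abs_lt_curve`, hence the correctness of the closed form. The variance
counter of the algorithm is `1 + V ≥ max 1 V` (`foldl_nextCounters`), so its intervals are larger
and contain the score as well.

The machine program is straight-line code with direct addressing, so its time and registers can be
bounded instruction by instruction.
-/

open scoped ENNReal

namespace AlignmentMonitoring

/-! ### The law of the trajectory -/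

section Trajectory

variable {X : Type*}

theorem history_zero (x : ℕ → X) : history x 0 = [] := by simp [history]

theorem history_succ (x : ℕ → X) (t : ℕ) : history x (t + 1) = history x t ++ [x t] := by
  simp only [history, List.ofFn_succ_last, Fin.val_castSucc, Fin.val_last]

theorem length_history (x : ℕ → X) (t : ℕ) : (history x t).length = t := by simp [history]

theorem take_history (x : ℕ → X) {s t : ℕ} (h : s ≤ t) :
    (history x t).take s = history x s := by
  apply List.ext_getElem
  · simp [history, h]
  · intro i h₁ h₂
    simp [history]

variable [MeasurableSpace X] [DiscreteMeasurableSpace X] [Countable X]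

instance (env : List X → PMF X) : IsProbabilityMeasure (envMeasure env) :=
  inferInstanceAs (IsProbabilityMeasure (Kernel.trajMeasure (X := fun _ => X) _ _))

theorem measurable_history_apply (F : List X → ℝ≥0∞) (t : ℕ) :
    Measurable fun x : ℕ → X => F (history x t) := by
  have h : (fun x : ℕ → X => F (history x t)) =
      (fun h : Fin t → X => F (List.ofFn h)) ∘ fun x i => x i := rfl
  rw [h]
  exact (measurable_of_countable _).comp (measurable_pi_lambda _ fun i => measurable_pi_apply _)

theorem envMeasure_map_zero (env : List X → PMF X) :
    (envMeasure env).map (fun x => x 0) = (env []).toMeasure := by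
  have h : (fun x : ℕ → X => x 0) =
      (fun h : (i : Finset.Iic 0) → (fun _ : ℕ => X) i => h ⟨0, Finset.mem_Iic.2 le_rfl⟩) ∘
        Preorder.frestrictLe (π := fun _ => X) 0 := rfl
  rw [h, ← Measure.map_map (by fun_prop) (by fun_prop), envMeasure, Kernel.trajMeasure,
    Measure.map_comp _ _ (by fun_prop), Kernel.traj_map_frestrictLe, Kernel.partialTraj_self,
    Measure.id_comp, Measure.map_map (by fun_prop) (by fun_prop)]
  exact Measure.map_id

/-- Given the first `t` states, the next one is distributed according to the environment. -/
theorem lintegral_history_succ (env : List X → PMF X) (F : List X → ℝ≥0∞) (t : ℕ) :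
    ∫⁻ x, F (history x (t + 1)) ∂envMeasure env =
      ∫⁻ x, ∫⁻ y, F (history x t ++ [y]) ∂(env (history x t)).toMeasure ∂envMeasure env := by
  rcases t with _ | n
  · simp only [history_succ, history_zero, lintegral_const, measure_univ, mul_one]
    rw [← envMeasure_map_zero, lintegral_map (measurable_of_countable _) (measurable_pi_apply 0)]
  · let G : ((i : Finset.Iic n) → (fun _ : ℕ => X) i) × X → ℝ≥0∞ := fun p =>
      F ((List.ofFn fun i : Fin (n + 1) =>
        p.1 ⟨i, Finset.mem_Iic.2 (Nat.lt_succ_iff.1 i.2)⟩) ++ [p.2])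
    have hG : Measurable G := measurable_of_countable _
    have key := Kernel.map_frestrictLe_trajMeasure_compProd_eq_map_trajMeasure
      (X := fun _ => X) (μ₀ := (env []).toMeasure) (κ := envKernel env) (a := n)
    have h := congrArg (fun μ => ∫⁻ p, G p ∂μ) key
    simp only at h
    rw [Measure.lintegral_compProd hG, lintegral_map (measurable_of_countable _) (by fun_prop),
      lintegral_map hG (by fun_prop)] at h
    simp only [history_succ _ (n + 1)]
    exact h.symm

end Trajectory

/-! ### Ville's inequality for functions of the history -/

section Ville

variable {X : Type*}

/-- The process `M`, frozen at the level `c` from the first time on at which it reaches `c`. -/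
noncomputable def stopAt (M : List X → ℝ≥0∞) (c : ℝ≥0∞) (h : List X) : ℝ≥0∞ :=
  open Classical in if ∃ i ≤ h.length, c ≤ M (h.take i) then c else M h

theorem stopAt_nil_le (M : List X → ℝ≥0∞) (c : ℝ≥0∞) : stopAt M c [] ≤ M [] := by
  unfold stopAt
  split_ifs with h
  · obtain ⟨i, -, hi⟩ := h
    simpa using hi
  · exact le_rfl

theorem stopAt_append_le (M : List X → ℝ≥0∞) (c : ℝ≥0∞) (h : List X) (y : X) :
    stopAt M c (h ++ [y]) ≤
      open Classical in if ∃ i ≤ h.length, c ≤ M (h.take i) then c else M (h ++ [y]) := by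
  unfold stopAt
  split_ifs with h₁ h₂ h₂
  · exact le_rfl
  · obtain ⟨i, hi, hc⟩ := h₁
    rcases Nat.lt_or_ge h.length i with hlt | hle
    · rwa [List.take_of_length_le (by simpa using hlt)] at hc
    · exact absurd ⟨i, hle, by rwa [List.take_append_of_le_length hle] at hc⟩ h₂
  · obtain ⟨i, hi, hc⟩ := h₂
    exact absurd ⟨i, by simp; omega, by rwa [List.take_append_of_le_length hi]⟩ h₁
  · exact le_rfl

variable [MeasurableSpace X] [DiscreteMeasurableSpace X] [Countable X]

/-- Ville's maximal inequality for nonnegative supermartingales. -/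
theorem envMeasure_exists_le (env : List X → PMF X) (M : List X → ℝ≥0∞)
    (hM : ∀ h, ∫⁻ y, M (h ++ [y]) ∂(env h).toMeasure ≤ M h) (c : ℝ≥0∞) :
    c * envMeasure env {x | ∃ t, c ≤ M (history x t)} ≤ M [] := by
  have step : ∀ h, ∫⁻ y, stopAt M c (h ++ [y]) ∂(env h).toMeasure ≤ stopAt M c h := by
    intro h
    refine (lintegral_mono fun y => stopAt_append_le M c h y).trans ?_
    unfold stopAt
    split_ifs
    · simp
    · exact hM h
  have bound : ∀ t, ∫⁻ x, stopAt M c (history x t) ∂envMeasure env ≤ M [] := by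
    intro t
    induction t with
    | zero => simpa [history_zero] using stopAt_nil_le M c
    | succ t ih =>
      rw [lintegral_history_succ]
      exact (lintegral_mono fun x => step _).trans ih
  have hmono : Monotone fun n => {x : ℕ → X | ∃ t ≤ n, c ≤ M (history x t)} :=
    fun m n hmn x ⟨t, ht, h⟩ => ⟨t, ht.trans hmn, h⟩
  have hU : {x : ℕ → X | ∃ t, c ≤ M (history x t)} =
      ⋃ n, {x : ℕ → X | ∃ t ≤ n, c ≤ M (history x t)} := by
    ext x
    simp only [Set.mem_ofPred_eq, Set.mem_iUnion]
    exact ⟨fun ⟨t, h⟩ => ⟨t, t, le_rfl, h⟩, fun ⟨_, t, _, h⟩ => ⟨t, h⟩⟩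
  rw [hU, hmono.measure_iUnion, ENNReal.mul_iSup]
  refine iSup_le fun n => le_trans ?_ (bound n)
  refine le_trans ?_ (mul_meas_ge_le_lintegral (measurable_history_apply _ n) c)
  refine mul_le_mul_right (measure_mono ?_) c
  rintro x ⟨t, ht, h⟩
  have : ∃ i ≤ (history x n).length, c ≤ M ((history x n).take i) :=
    ⟨t, by rwa [length_history], by rwa [take_history x ht]⟩
  simp [stopAt, this]

end Ville

/-! ### The exponential supermartingale inequality -/

/-- The inequality `s ≤ sinh s` at `s = -log w ≥ 0`. -/
theorem half_sub_inv_le_log {w : ℝ} (h₀ : 0 < w) (h₁ : w ≤ 1) : (w - w⁻¹) / 2 ≤ Real.log w := by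
  rw [← Real.sinh_log h₀]
  have := Real.self_le_sinh_iff.2 (neg_nonneg.2 (Real.log_nonpos h₀.le h₁))
  rw [Real.sinh_neg] at this
  linarith

/-- The quadratic term is moved into the exponent, where the *observed* square compensates the
convexity of `exp`. Its coefficient is the sub-gamma rate `1 / (2 * (1 - q))`. -/
theorem exp_sub_sq_le {z q : ℝ} (hq₀ : 0 ≤ q) (hq : q < 1) (hz : -q ≤ z) :
    Real.exp (z - z ^ 2 / (2 * (1 - q))) ≤ 1 + z := by
  have h₁ : 0 < 1 - q := by linarith
  have h₂ : 0 < 1 + z := by linarith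
  rw [← Real.le_log_iff_exp_le h₂]
  rcases le_total 0 z with h | h
  · refine le_trans ?_ (Real.le_log_one_add_of_nonneg h)
    have : z ^ 2 / 2 ≤ z ^ 2 / (2 * (1 - q)) := by gcongr; linarith
    refine (sub_le_sub_left this z).trans ?_
    rw [le_div_iff₀ (by linarith)]
    nlinarith [pow_nonneg h 3]
  · refine le_trans ?_ (half_sub_inv_le_log h₂ (by linarith))
    have : z ^ 2 / (2 * (1 + z)) ≤ z ^ 2 / (2 * (1 - q)) := by gcongr; linarith
    refine (sub_le_sub_left this z).trans (le_of_eq ?_)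
    field_simp
    ring

section OneStep

variable {X : Type*} [MeasurableSpace X] [DiscreteMeasurableSpace X] [Countable X]

theorem integrable_of_forall_mem_Icc (p : PMF X) {f : X → ℝ} {a b : ℝ}
    (hf : ∀ x, f x ∈ Set.Icc a b) : Integrable f p.toMeasure :=
  Integrable.of_mem_Icc a b (measurable_of_countable f).aemeasurable
    (Filter.Eventually.of_forall hf)

theorem sq_sub_projection_le {a b y m : ℝ} (hy : y ∈ Set.Icc a b) :
    (y - max a (min b m)) ^ 2 ≤ (y - m) ^ 2 := by
  obtain ⟨h₁, h₂⟩ := hy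
  rcases le_total b m with h | h
  · rw [min_eq_left h, max_eq_right (h₁.trans h₂)]
    nlinarith
  · rw [min_eq_right h]
    rcases le_total a m with h' | h'
    · rw [max_eq_right h']
    · rw [max_eq_left h']
      nlinarith

/-- The one-step supermartingale inequality behind the empirical Bernstein bound. The guess `m` of
the next value is arbitrary: moving it into `[a, b]` only decreases the squared error. -/
theorem lintegral_exp_le_one (p : PMF X) {f : X → ℝ} {a b : ℝ} (hf : ∀ x, f x ∈ Set.Icc a b)
    {r : ℝ} (hr : 0 ≤ r) (hr' : (b - a) * r < 1) (m : ℝ) :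
    ∫⁻ x, ENNReal.ofReal (Real.exp (r * (f x - ∫ x, f x ∂p.toMeasure) -
      r ^ 2 / (2 * (1 - (b - a) * r)) * (f x - m) ^ 2)) ∂p.toMeasure ≤ 1 := by
  set μ := ∫ x, f x ∂p.toMeasure with hμ
  set m' := max a (min b m) with hm'
  obtain ⟨x₀, -⟩ := p.support_nonempty
  have hab : a ≤ b := (hf x₀).1.trans (hf x₀).2
  have hint := integrable_of_forall_mem_Icc p hf
  have hm'b : m' ≤ b := max_le hab (min_le_left _ _)
  have h₁ : 0 < 1 - (b - a) * r := by linarith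
  have hlow : ∀ x, -((b - a) * r) ≤ r * (f x - m') := fun x => by nlinarith [(hf x).1]
  have hpt : ∀ x, Real.exp (r * (f x - μ) - r ^ 2 / (2 * (1 - (b - a) * r)) * (f x - m) ^ 2) ≤
      Real.exp (r * (m' - μ)) * (1 + r * (f x - m')) := by
    intro x
    refine le_trans ?_ (mul_le_mul_of_nonneg_left
      (exp_sub_sq_le (mul_nonneg (by linarith) hr) hr' (hlow x)) (Real.exp_pos _).le)
    rw [← Real.exp_add]
    apply Real.exp_le_exp.2
    have h₂ : 0 ≤ r ^ 2 / (2 * (1 - (b - a) * r)) := by positivity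
    have h₃ := mul_le_mul_of_nonneg_left (sq_sub_projection_le (m := m) (hf x)) h₂
    rw [← hm'] at h₃
    have h₄ : (r * (f x - m')) ^ 2 / (2 * (1 - (b - a) * r)) =
        r ^ 2 / (2 * (1 - (b - a) * r)) * (f x - m') ^ 2 := by ring
    rw [h₄]
    linarith
  refine (lintegral_mono fun x => ENNReal.ofReal_le_ofReal (hpt x)).trans ?_
  rw [← ofReal_integral_eq_lintegral_ofReal]
  · apply ENNReal.ofReal_le_one.2
    have hmean : ∫ x, (1 + r * (f x - m')) ∂p.toMeasure = 1 + r * (μ - m') := by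
      have hm : Integrable (fun x => f x - m') p.toMeasure := hint.sub (integrable_const m')
      rw [integral_add (integrable_const 1) (hm.const_mul r), integral_const_mul,
        integral_sub hint (integrable_const m'), ← hμ]
      simp
    rw [integral_const_mul, hmean]
    calc Real.exp (r * (m' - μ)) * (1 + r * (μ - m'))
        ≤ Real.exp (r * (m' - μ)) * Real.exp (r * (μ - m')) := by
          gcongr
          linarith [Real.add_one_le_exp (r * (μ - m'))]
      _ = 1 := by rw [← Real.exp_add, ← Real.exp_zero]; congr 1; ring
  · exact (((integrable_const _).add ((hint.sub (integrable_const _)).const_mul _)).const_mul _)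
  · refine Filter.Eventually.of_forall fun x => ?_
    have := hlow x
    exact mul_nonneg (Real.exp_pos _).le (by linarith)

end OneStep

/-! ### The stitched boundary -/

section Boundary

/-- The curve `√(2.13 v x + 1.76 c² x²) + 1.33 c x`; at `x = stitch v δ` it is `t` times the
half-width of the confidence interval. -/
noncomputable def curve (c v x : ℝ) : ℝ :=
  √(2.13 * v * x + 1.76 * c ^ 2 * x ^ 2) + 1.33 * c * x

theorem halfWidth_eq (t n δ σ : ℝ) : halfWidth t n δ σ = curve σ n (stitch n δ) / t := rfl

theorem curve_le_curve {c v v' x x' : ℝ} (hc : 0 ≤ c) (hv : 0 ≤ v) (hx : 0 ≤ x) (hvv : v ≤ v')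
    (hxx : x ≤ x') : curve c v x ≤ curve c v' x' := by
  have hv' := hv.trans hvv
  unfold curve
  gcongr

theorem log_exp_one_mul {n : ℝ} (hn : 0 < n) : Real.log (Real.exp 1 * n) = 1 + Real.log n := by
  rw [Real.log_mul (Real.exp_pos 1).ne' hn.ne', Real.log_exp]

theorem stitch_le_stitch {n n' : ℝ} (δ : ℝ) (hn : 1 ≤ n) (h : n ≤ n') :
    stitch n δ ≤ stitch n' δ := by
  have h₀ : 0 < n := by linarith
  have := Real.log_nonneg hn
  have := Real.pi_pos
  unfold stitch
  rw [log_exp_one_mul h₀, log_exp_one_mul (h₀.trans_le h)]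
  gcongr

theorem stitch_pos {n δ : ℝ} (hn : 1 ≤ n) (hδ : 0 < δ) (hδ' : δ < 1) : 0 < stitch n δ := by
  refine lt_of_lt_of_le ?_ (stitch_le_stitch δ le_rfl hn)
  have h₁ : 0 < Real.log (2 / δ) := Real.log_pos (by rw [lt_div_iff₀ hδ]; linarith)
  have h₂ : 0 ≤ Real.log (Real.pi * Real.log (Real.exp 1 * 1) / √6) := by
    apply Real.log_nonneg
    rw [mul_one, Real.log_exp, mul_one, le_div_iff₀ (by positivity), one_mul]
    calc √6 ≤ 3 := by rw [Real.sqrt_le_left (by norm_num)]; norm_num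
      _ ≤ Real.pi := Real.pi_gt_three.le
  unfold stitch
  linarith

/-- The error probabilities of the epochs add up to `δ / 2`. -/
theorem hasSum_exp_neg_stitch {δ : ℝ} (hδ : 0 < δ) :
    HasSum (fun k : ℕ => Real.exp (-stitch (Real.exp k) δ)) (δ / 2) := by
  have h := ((hasSum_nat_add_iff' 1).2 hasSum_zeta_two).mul_left (6 / Real.pi ^ 2 * (δ / 2))
  have hpi := Real.pi_pos
  have hterm : ∀ k : ℕ, Real.exp (-stitch (Real.exp k) δ) =
      6 / Real.pi ^ 2 * (δ / 2) * (1 / ((k + 1 : ℕ) : ℝ) ^ 2) := by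
    intro k
    have h₁ : 0 < Real.pi * ((1 : ℝ) + k) / √6 := by positivity
    rw [stitch, log_exp_one_mul (Real.exp_pos _), Real.log_exp, neg_add, Real.exp_add,
      ← Real.log_inv, Real.exp_log (by positivity), ← mul_neg, ← Real.log_inv, mul_comm (2 : ℝ),
      Real.exp_mul, Real.exp_log (by positivity), Real.rpow_two]
    have h6 : √(6 : ℝ) ^ 2 = 6 := Real.sq_sqrt (by norm_num)
    rw [inv_div, inv_div, div_pow, h6]
    push_cast
    field_simp
    ring
  have hsum : δ / 2 = 6 / Real.pi ^ 2 * (δ / 2) *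
      (Real.pi ^ 2 / 6 - ∑ i ∈ Finset.range 1, (1 : ℝ) / (i : ℝ) ^ 2) := by
    simp
    field_simp
  rw [← hsum] at h
  rw [funext hterm]
  exact h

/-- The parameter of the exponential supermartingale for an epoch of level `x` around the intrinsic
time `w`: the solution `r` of `r ^ 2 / (2 * (1 - c * r)) = x / w`, which lets the line
`r * S - x / w * V = x` meet the curve `√(2 w x + c² x²) + c x` at `V = w`. -/
noncomputable def slope (c x w : ℝ) : ℝ := 2 / (c + √(c ^ 2 + 2 * w / x))

variable {c x w : ℝ}

theorem lt_sqrt_slope (hx : 0 < x) (hw : 0 < w) : c < √(c ^ 2 + 2 * w / x) := by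
  apply Real.lt_sqrt_of_sq_lt
  have : 0 < 2 * w / x := by positivity
  linarith

theorem slope_pos (hc : 0 ≤ c) (hx : 0 < x) (hw : 0 < w) : 0 < slope c x w := by
  have := lt_sqrt_slope (c := c) hx hw
  unfold slope
  positivity

theorem mul_slope_lt_one (hc : 0 ≤ c) (hx : 0 < x) (hw : 0 < w) : c * slope c x w < 1 := by
  have := lt_sqrt_slope (c := c) hx hw
  unfold slope
  rw [mul_div_assoc', div_lt_one (by linarith)]
  linarith

theorem slope_spec (hc : 0 ≤ c) (hx : 0 < x) (hw : 0 < w) :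
    slope c x w ^ 2 / (2 * (1 - c * slope c x w)) = x / w := by
  have h := lt_sqrt_slope (c := c) hx hw
  have hs : √(c ^ 2 + 2 * w / x) ^ 2 = c ^ 2 + 2 * w / x := Real.sq_sqrt (by positivity)
  have h₁ := mul_slope_lt_one hc hx hw
  unfold slope at *
  set s := √(c ^ 2 + 2 * w / x)
  have h₂ : 0 < c + s := by linarith
  have h₃ : 1 - c * (2 / (c + s)) = (s - c) / (c + s) := by field_simp; ring
  have h₄ : 0 < s - c := by linarith
  have h₅ : (s - c) * (c + s) = 2 * w / x := by linear_combination hs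
  have h₆ : (2 / (c + s)) ^ 2 / (2 * ((s - c) / (c + s))) = 2 / ((s - c) * (c + s)) := by
    field_simp
  rw [h₃, h₆, h₅]
  field_simp

theorem exp_half_bounds : 1.6487 < Real.exp (1 / 2) ∧ Real.exp (1 / 2) < 1.6488 := by
  have h : Real.exp (1 / 2) ^ 2 = Real.exp 1 := by
    rw [← Real.exp_nat_mul]
    norm_num
  have h₁ := Real.exp_one_gt_d9
  have h₂ := Real.exp_one_lt_d9
  have h₃ := Real.exp_pos (1 / 2)
  constructor <;> nlinarith

/-- During an epoch, whose intrinsic time `v` stays within a factor `√e` of `w`, the straight line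
`slope c x w * S - x / w * V = x` lies below the curve. The constants `2.13`, `1.76` and `1.33` are
upper bounds of `(e ^ (1/4) + e ^ (-1/4)) ^ 2 / 2`, `((1 + √e) / 2) ^ 2` and `(1 + √e) / 2`. -/
theorem lt_curve {v V S : ℝ} (hc : 0 ≤ c) (hx : 0 < x) (hw : 0 < w) (hV : V ≤ v)
    (h₁ : w ≤ Real.exp (1 / 2) * v) (h₂ : v ≤ Real.exp (1 / 2) * w)
    (hS : slope c x w * S - x / w * V < x) : S < curve c v x := by
  obtain ⟨hr₁, hr₂⟩ := exp_half_bounds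
  set r := Real.exp (1 / 2)
  have hsl := lt_sqrt_slope (c := c) hx hw
  obtain ⟨ρ, rfl⟩ : ∃ ρ, v = ρ * w := ⟨v / w, by field_simp⟩
  have hρ₁ : 1 ≤ r * ρ := by
    by_contra! h
    nlinarith
  have hρ₂ : ρ ≤ r := le_of_mul_le_mul_right h₂ hw
  have hρ : 0 < ρ := by
    by_contra! h
    nlinarith
  have hline : slope c x w * S < x * (1 + ρ) := by
    have : x / w * V ≤ x / w * (ρ * w) := by gcongr
    have h : x / w * (ρ * w) = x * ρ := by field_simp
    linarith
  have hS' : S < (1 + ρ) / 2 * √(c ^ 2 * x ^ 2 + 2 * w * x) + (1 + ρ) / 2 * c * x := by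
    have h₃ : √(c ^ 2 * x ^ 2 + 2 * w * x) = x * √(c ^ 2 + 2 * w / x) := by
      rw [← Real.sqrt_sq hx.le, ← Real.sqrt_mul (by positivity), Real.sqrt_sq hx.le]
      congr 1
      field_simp
    rw [h₃]
    have h₄ : slope c x w * ((1 + ρ) / 2 * (x * √(c ^ 2 + 2 * w / x)) + (1 + ρ) / 2 * c * x) =
        x * (1 + ρ) := by
      unfold slope
      have : 0 < c + √(c ^ 2 + 2 * w / x) := by linarith
      field_simp
      ring
    rw [← h₄] at hline
    exact lt_of_mul_lt_mul_left hline (slope_pos hc hx hw).le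
  refine hS'.trans_le ?_
  unfold curve
  have h₅ : (1 + ρ) / 2 ≤ 1.33 := by linarith
  refine add_le_add ?_ (by gcongr)
  apply Real.le_sqrt_of_sq_le
  rw [mul_pow, Real.sq_sqrt (by positivity)]
  have h₆ : ((1 + ρ) / 2) ^ 2 ≤ 1.76 := by nlinarith
  -- the quadratic `(ρ - r) * (ρ - 1 / r)` is nonpositive between its roots
  have h₇ : (1 + ρ) ^ 2 / 2 ≤ 2.13 * ρ := by
    have : (r - ρ) * (r * ρ - 1) ≥ 0 := mul_nonneg (by linarith) (by linarith)
    have h₈ : r ^ 2 + 1 ≤ 2.26 * r := by nlinarith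
    nlinarith
  have h₉ : ((1 + ρ) / 2) ^ 2 * (c ^ 2 * x ^ 2) ≤ 1.76 * (c ^ 2 * x ^ 2) := by gcongr
  have h₁₀ : (1 + ρ) ^ 2 / 2 * (w * x) ≤ 2.13 * ρ * (w * x) := by gcongr
  linarith

end Boundary

/-! ### The stitched empirical Bernstein bound -/

section Deviation

variable {X : Type*} [MeasurableSpace X] [DiscreteMeasurableSpace X] [Countable X]

/-- One side of the stitched empirical Bernstein bound. Here `S` is the sum of the centred values
`f h y`, and `V` the sum of their squared distances to predictions `m h` made in advance. -/
theorem envMeasure_curve_le (env : List X → PMF X) {f : List X → X → ℝ} {a b : ℝ}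
    (hf : ∀ h y, f h y ∈ Set.Icc a b) (m S V : List X → ℝ) (hS₀ : S [] = 0) (hV₀ : V [] = 0)
    (hS : ∀ h y, S (h ++ [y]) = S h + (f h y - ∫ x, f h x ∂(env h).toMeasure))
    (hV : ∀ h y, V (h ++ [y]) = V h + (f h y - m h) ^ 2) {δ : ℝ} (hδ : 0 < δ) (hδ' : δ < 1) :
    envMeasure env {x | ∃ t, curve (b - a) (max 1 (V (history x t)))
      (stitch (max 1 (V (history x t))) δ) ≤ S (history x t)} ≤ ENNReal.ofReal (δ / 2) := by
  obtain ⟨x₀, -⟩ := (env []).support_nonempty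
  have hc : 0 ≤ b - a := sub_nonneg.2 ((hf [] x₀).1.trans (hf [] x₀).2)
  set c := b - a with hcdef
  -- level, centre and slope parameter of the epoch in which the intrinsic time is about `e ^ k`
  let x : ℕ → ℝ := fun k => stitch (Real.exp k) δ
  let w : ℕ → ℝ := fun k => Real.exp (k + 1 / 2)
  let r : ℕ → ℝ := fun k => slope c (x k) (w k)
  have hx : ∀ k, 0 < x k := fun k => stitch_pos (Real.one_le_exp k.cast_nonneg) hδ hδ'
  have hw : ∀ k, 0 < w k := fun k => Real.exp_pos _
  let M : ℕ → List X → ENNReal := fun k h =>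
    ENNReal.ofReal (Real.exp (r k * S h - x k / w k * V h))
  have hM : ∀ k h, ∫⁻ y, M k (h ++ [y]) ∂(env h).toMeasure ≤ M k h := by
    intro k h
    have hone := lintegral_exp_le_one (env h) (hf h) (slope_pos hc (hx k) (hw k)).le
      (mul_slope_lt_one hc (hx k) (hw k)) (m h)
    rw [slope_spec hc (hx k) (hw k)] at hone
    have hstep : ∀ y, M k (h ++ [y]) = M k h * ENNReal.ofReal (Real.exp
        (r k * (f h y - ∫ x, f h x ∂(env h).toMeasure) - x k / w k * (f h y - m h) ^ 2)) := by
      intro y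
      simp only [M]
      rw [← ENNReal.ofReal_mul (Real.exp_pos _).le, ← Real.exp_add, hS, hV]
      congr 2
      ring
    simp only [hstep]
    rw [lintegral_const_mul _ (measurable_of_countable _)]
    exact mul_le_of_le_one_right' hone
  have hepoch : ∀ k,
      envMeasure env {z | ∃ t, ENNReal.ofReal (Real.exp (x k)) ≤ M k (history z t)} ≤
        ENNReal.ofReal (Real.exp (-x k)) := by
    intro k
    have h := envMeasure_exists_le env (M k) (hM k) (ENNReal.ofReal (Real.exp (x k)))
    have hM₀ : M k [] = 1 := by simp [M, hS₀, hV₀]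
    rw [hM₀] at h
    rw [Real.exp_neg, ENNReal.ofReal_inv_of_pos (Real.exp_pos _)]
    exact (ENNReal.le_inv_iff_mul_le).2 (by rwa [mul_comm])
  have hsub : {z | ∃ t, curve c (max 1 (V (history z t)))
      (stitch (max 1 (V (history z t))) δ) ≤ S (history z t)} ⊆
      ⋃ k, {z | ∃ t, ENNReal.ofReal (Real.exp (x k)) ≤ M k (history z t)} := by
    rintro z ⟨t, ht⟩
    set v := max 1 (V (history z t)) with hv
    have hv₁ : 1 ≤ v := le_max_left _ _
    have hv₀ : 0 < v := by linarith
    let k := ⌊Real.log v⌋₊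
    have hk₁ : (k : ℝ) ≤ Real.log v := Nat.floor_le (Real.log_nonneg hv₁)
    have hk₂ : Real.log v < k + 1 := Nat.lt_floor_add_one _
    have he₁ : Real.exp k ≤ v := (Real.le_log_iff_exp_le hv₀).1 hk₁
    have he₂ : v ≤ Real.exp (k + 1) := ((Real.log_lt_iff_lt_exp hv₀).1 hk₂).le
    refine Set.mem_iUnion.2 ⟨k, t, ENNReal.ofReal_le_ofReal (Real.exp_le_exp.2 ?_)⟩
    by_contra! hlt
    have hcurve : S (history z t) < curve c v (x k) := by
      refine lt_curve hc (hx k) (hw k) (le_max_right _ _) ?_ ?_ hlt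
      · calc w k = Real.exp (1 / 2) * Real.exp k := by rw [← Real.exp_add, add_comm]
          _ ≤ _ := by gcongr
      · calc v ≤ Real.exp (k + 1) := he₂
          _ = _ := by rw [← Real.exp_add]; congr 1; ring
    exact absurd (hcurve.trans_le (curve_le_curve hc hv₀.le (hx k).le le_rfl
      (stitch_le_stitch δ (Real.one_le_exp k.cast_nonneg) he₁))) ht.not_gt
  have hsum := hasSum_exp_neg_stitch hδ
  calc _ ≤ _ := measure_mono hsub
    _ ≤ _ := measure_iUnion_le _
    _ ≤ ∑' k, ENNReal.ofReal (Real.exp (-x k)) := ENNReal.tsum_le_tsum hepoch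
    _ = _ := by
      rw [← ENNReal.ofReal_tsum_of_nonneg (fun k => (Real.exp_pos _).le) hsum.summable,
        hsum.tsum_eq]

/-- The two-sided stitched empirical Bernstein bound. -/
theorem le_envMeasure_abs_lt_curve (env : List X → PMF X) {f : List X → X → ℝ} {a b : ℝ}
    (hf : ∀ h y, f h y ∈ Set.Icc a b) (m S V : List X → ℝ) (hS₀ : S [] = 0) (hV₀ : V [] = 0)
    (hS : ∀ h y, S (h ++ [y]) = S h + (f h y - ∫ x, f h x ∂(env h).toMeasure))
    (hV : ∀ h y, V (h ++ [y]) = V h + (f h y - m h) ^ 2) {δ : ℝ} (hδ : 0 < δ) (hδ' : δ < 1) :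
    ENNReal.ofReal (1 - δ) ≤ envMeasure env {x | ∀ t, |S (history x t)| <
      curve (b - a) (max 1 (V (history x t))) (stitch (max 1 (V (history x t))) δ)} := by
  have hup := envMeasure_curve_le env hf m S V hS₀ hV₀ hS hV hδ hδ'
  have hlow := envMeasure_curve_le env (f := fun h y => -f h y) (a := -b) (b := -a)
    (fun h y => ⟨neg_le_neg (hf h y).2, neg_le_neg (hf h y).1⟩) (fun h => -m h)
    (fun h => -S h) V (by simp [hS₀]) hV₀
    (fun h y => by rw [hS, integral_neg]; ring) (fun h y => by rw [hV]; ring) hδ hδ'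
  rw [neg_sub_neg] at hlow
  set A := {x | ∀ t, |S (history x t)| <
    curve (b - a) (max 1 (V (history x t))) (stitch (max 1 (V (history x t))) δ)}
  have hcompl : envMeasure env Aᶜ ≤ ENNReal.ofReal δ := by
    rw [← add_halves δ, ENNReal.ofReal_add (by linarith) (by linarith)]
    refine (measure_mono ?_).trans ((measure_union_le _ _).trans (add_le_add hup hlow))
    intro x hx
    simp only [A, Set.mem_compl_iff, Set.mem_ofPred_eq, not_forall, not_lt] at hx
    obtain ⟨t, ht⟩ := hx
    exact (le_abs.1 ht).imp (fun h => ⟨t, h⟩) (fun h => ⟨t, h⟩)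
  have hone : 1 ≤ envMeasure env A + envMeasure env Aᶜ := by
    rw [← measure_univ (μ := envMeasure env), ← Set.union_compl_self A]
    exact measure_union_le _ _
  rw [ENNReal.ofReal_sub _ hδ.le, ENNReal.ofReal_one]
  exact tsub_le_iff_right.2 (hone.trans (add_le_add le_rfl hcompl))

end Deviation

/-! ### The counters of the monitor in closed form -/

section Histories

variable {X α : Type*}

/-- The list of the values `f h y`, where `y` runs through the entries of a list and `h` is the
part of the list before `y`. -/
def alongHistory (f : List X → X → α) (h : List X) : List α :=
  List.ofFn fun i : Fin h.length => f (h.take i) h[i]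

theorem alongHistory_append (f : List X → X → α) (h : List X) (y : X) :
    alongHistory f (h ++ [y]) = alongHistory f h ++ [f h y] := by
  apply List.ext_getElem
  · simp [alongHistory]
  · intro i h₁ h₂
    simp only [alongHistory, List.length_ofFn, List.length_append, List.length_singleton] at h₁
    rcases Nat.lt_succ_iff_lt_or_eq.1 h₁ with hi | rfl
    · simp [alongHistory, hi, List.getElem_append, List.take_append_of_le_length hi.le,
        -List.ofFn_succ]
    · simp [alongHistory, -List.ofFn_succ]

theorem alongHistory_history (f : List X → X → α) (x : ℕ → X) (t : ℕ) :
    alongHistory f (history x t) = List.ofFn fun i : Fin t => f (history x i) (x i) := by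
  induction t with
  | zero => simp [alongHistory, history_zero]
  | succ t ih =>
    rw [history_succ, alongHistory_append, ih, List.ofFn_succ_last]
    simp

variable (ℓ : PMF X → X → ℝ)

theorem sum_sq_append (w : List (PMF X × X)) (p : PMF X × X) :
    empiricalVariance ℓ (w ++ [p]) =
      empiricalVariance ℓ w + (ℓ p.1 p.2 - averageScore ℓ w) ^ 2 := by
  have key : ∀ w : List (PMF X × X), empiricalVariance ℓ w =
      (alongHistory (fun h q => (ℓ q.1 q.2 - averageScore ℓ h) ^ 2) w).sum := by
    intro w
    rw [alongHistory, List.sum_ofFn]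
    rfl
  rw [key, key, alongHistory_append]
  simp

theorem foldl_nextCounters_append (w : List (PMF X × X)) (p : PMF X × X) :
    (w ++ [p]).foldl (nextCounters ℓ) initCounters =
      nextCounters ℓ (w.foldl (nextCounters ℓ) initCounters) p := by
  simp

/-- The counters in closed form. The variance counter starts at `1` and never decreases, so the
maximum in its update is inactive and it exceeds the empirical variance by exactly `1`. -/
theorem foldl_nextCounters (w : List (PMF X × X)) :
    w.foldl (nextCounters ℓ) initCounters =
      ⟨w.length, averageScore ℓ w, 1 + empiricalVariance ℓ w⟩ := by
  induction w using List.reverseRecOn with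
  | nil => simp [initCounters, averageScore, empiricalVariance]
  | append_singleton w p ih =>
    have hnonneg : 0 ≤ empiricalVariance ℓ w := Finset.sum_nonneg fun i _ => sq_nonneg _
    rw [foldl_nextCounters_append, ih, sum_sq_append]
    simp only [nextCounters, Counters.mk.injEq, List.length_append, List.length_singleton, true_and]
    constructor
    · rcases Nat.eq_zero_or_pos w.length with h | h
      · obtain rfl := List.length_eq_zero_iff.1 h
        simp [averageScore]
      · have h' : (w.length : ℝ) ≠ 0 := by positivity
        simp [averageScore]
        field_simp
    · rw [max_eq_right (by nlinarith [sq_nonneg (ℓ p.1 p.2 - averageScore ℓ w)])]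
      ring

theorem alignmentMonitor_eq (a b δ : ℝ) (w : List (PMF X × X)) :
    alignmentMonitor ℓ a b δ w =
      (averageScore ℓ w - halfWidth w.length (1 + empiricalVariance ℓ w) δ (b - a),
        averageScore ℓ w + halfWidth w.length (1 + empiricalVariance ℓ w) δ (b - a)) := by
  unfold alignmentMonitor
  rw [foldl_nextCounters]

end Histories

/-! ### Correctness of the monitors -/

section Correctness

variable {X : Type*} [MeasurableSpace X] [DiscreteMeasurableSpace X] [Countable X]

/-- Both monitors are correct since their intervals are centred at the average score and have at
least the half-width given by the variance `max 1 (empiricalVariance ℓ w)`. -/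
theorem solvesAlignmentProblem_of_le {ℓ : PMF X → X → ℝ} {a b δ : ℝ}
    (hℓ : ∀ y x, ℓ y x ∈ Set.Icc a b) (hδ : 0 < δ) (hδ' : δ < 1) {n : List (PMF X × X) → ℝ}
    (hn : ∀ w, max 1 (empiricalVariance ℓ w) ≤ n w) :
    SolvesAlignmentProblem (averageExpectedScore ℓ)
      (fun w => (averageScore ℓ w - halfWidth w.length (n w) δ (b - a),
        averageScore ℓ w + halfWidth w.length (n w) δ (b - a))) δ := by
  intro env model
  let obs : List X → List (PMF X × X) := alongHistory fun h y => (model h, y)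
  let hid : List X → List (PMF X × PMF X) := alongHistory fun h _ => (model h, env h)
  have hobs : ∀ x t, obs (history x t) = observed model x t := fun x t => alongHistory_history _ _ _
  have hhid : ∀ x t, hid (history x t) = hidden model env x t :=
    fun x t => alongHistory_history _ _ _
  let S : List X → ℝ := fun h => ((obs h).map fun p => ℓ p.1 p.2).sum -
    ((hid h).map fun p => ∫ x, ℓ p.1 x ∂p.2.toMeasure).sum
  have hmain := le_envMeasure_abs_lt_curve env (f := fun h y => ℓ (model h) y)
    (fun h y => hℓ _ _) (fun h => averageScore ℓ (obs h)) S
    (fun h => empiricalVariance ℓ (obs h)) (by simp [S, obs, hid, alongHistory])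
    (show empiricalVariance ℓ [] = 0 by simp [empiricalVariance])
    (fun h y => by
      simp only [S, obs, hid, alongHistory_append, List.map_append, List.map_singleton,
        List.sum_append, List.sum_singleton]
      ring)
    (fun h y => by simp only [obs, alongHistory_append, sum_sq_append]) hδ hδ'
  refine hmain.trans (measure_mono ?_)
  intro x hx t ht
  have hxt := (hx t).le
  have hlen : (observed model x t).length = t := by simp [observed]
  have hlen' : (hidden model env x t).length = t := by simp [hidden]
  simp only [hobs, hhid, S] at hxt
  have hab : a ≤ b := (hℓ (env []) (x 0)).1.trans (hℓ (env []) (x 0)).2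
  have ht₀ : (0 : ℝ) < t := by exact_mod_cast ht
  set w := observed model x t
  have hn₁ := le_max_left 1 (empiricalVariance ℓ w)
  have hle := hxt.trans (curve_le_curve (sub_nonneg.2 hab) (zero_le_one.trans hn₁)
    (stitch_pos hn₁ hδ hδ').le (hn w) (stitch_le_stitch δ hn₁ (hn w)))
  have hdiff : |averageScore ℓ w - averageExpectedScore ℓ (hidden model env x t)| ≤
      halfWidth w.length (n w) δ (b - a) := by
    rw [halfWidth_eq, averageScore, averageExpectedScore, hlen, hlen', ← sub_div, abs_div,
      abs_of_pos ht₀]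
    gcongr
  obtain ⟨h₁, h₂⟩ := abs_le.1 hdiff
  exact ⟨by dsimp only; linarith, by dsimp only; linarith⟩

theorem solvesAlignmentProblem_confidenceInterval {ℓ : PMF X → X → ℝ} {a b δ : ℝ}
    (hℓ : ∀ y x, ℓ y x ∈ Set.Icc a b) (hδ : 0 < δ) (hδ' : δ < 1) :
    SolvesAlignmentProblem (averageExpectedScore ℓ) (confidenceInterval ℓ a b δ) δ :=
  solvesAlignmentProblem_of_le hℓ hδ hδ' fun _ => le_rfl

theorem solvesAlignmentProblem_alignmentMonitor {ℓ : PMF X → X → ℝ} {a b δ : ℝ}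
    (hℓ : ∀ y x, ℓ y x ∈ Set.Icc a b) (hδ : 0 < δ) (hδ' : δ < 1) :
    SolvesAlignmentProblem (averageExpectedScore ℓ) (alignmentMonitor ℓ a b δ) δ := by
  rw [funext (alignmentMonitor_eq ℓ a b δ)]
  refine solvesAlignmentProblem_of_le hℓ hδ hδ' fun w => ?_
  have hnonneg : 0 ≤ empiricalVariance ℓ w := Finset.sum_nonneg fun i _ => sq_nonneg _
  exact max_le (by linarith) (by linarith)

end Correctness

/-! ### Straight-line programs -/

section StraightLine

/-- The instruction is neither a jump nor indirectly addressed, and it mentions only registers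
below `K`. -/
def Instr.Direct (K : ℕ) : Instr → Prop
  | .const d _ => d < K
  | .add d i j | .sub d i j | .mul d i j | .div d i j | .max d i j => d < K ∧ i < K ∧ j < K
  | .sqrt d i | .log d i => d < K ∧ i < K
  | .load _ _ | .store _ _ | .jumpLe _ _ _ => False
  | .score d => d < K

theorem Instr.Direct.exec_pc {K : ℕ} {i : Instr} (hi : i.Direct K) (s : ℝ) (τ : ℕ) (c : Config) :
    (i.exec s τ c).pc = c.pc + 1 := by
  cases i <;> first | rfl | exact hi.elim

theorem Instr.Direct.exec_used {K : ℕ} {i : Instr} (hi : i.Direct K) (s : ℝ) (τ : ℕ) {c : Config}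
    (hc : c.used ⊆ Finset.range K) : (i.exec s τ c).used ⊆ Finset.range K := by
  cases i <;> simp_all [Instr.Direct, Instr.exec, Config.write,
    Finset.insert_subset_iff]

theorem Instr.exec_time_le (i : Instr) (s : ℝ) {τ : ℕ} (hτ : 1 ≤ τ) (c : Config) :
    (i.exec s τ c).time ≤ c.time + τ := by
  cases i <;> simp [Instr.exec, Config.write, hτ]

/-- Execute all instructions of a list, one after the other. -/
noncomputable def execAll (s : ℝ) (τ : ℕ) (prog : List Instr) (c : Config) : Config :=
  prog.foldl (fun c i => i.exec s τ c) c

theorem execAll_append (s : ℝ) (τ : ℕ) (p q : List Instr) (c : Config) :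
    execAll s τ (p ++ q) c = execAll s τ q (execAll s τ p c) := List.foldl_append

variable {K : ℕ} {prog : List Instr}

/-- A straight-line suffix of a program, started at its first instruction, is executed one
instruction after the other. -/
theorem iterate_step_eq_execAll (s : ℝ) (τ : ℕ) (hprog : ∀ i ∈ prog, i.Direct K) (pre : List Instr)
    (c : Config) (hc : c.pc = pre.length) :
    (step (pre ++ prog) s τ)^[prog.length] c = execAll s τ prog c ∧
      (execAll s τ prog c).pc = (pre ++ prog).length := by
  induction prog generalizing pre c with
  | nil => simp [execAll, hc]
  | cons i prog ih =>
    have hstep : step (pre ++ i :: prog) s τ c = i.exec s τ c := by simp [step, hc]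
    have hi := hprog i List.mem_cons_self
    have h := ih (fun j hj => hprog j (List.mem_cons_of_mem _ hj)) (pre ++ [i]) (i.exec s τ c)
      (by simp [hi.exec_pc, hc])
    rw [List.append_assoc, List.singleton_append] at h
    rwa [List.length_cons, Function.iterate_succ_apply, hstep]

/-- Every instruction costs at most `τ`, because unit cost is at most the cost of a score. -/
theorem execAll_time_le (s : ℝ) {τ : ℕ} (hτ : 1 ≤ τ) (prog : List Instr) (c : Config) :
    (execAll s τ prog c).time ≤ c.time + prog.length * τ := by
  induction prog generalizing c with
  | nil => simp [execAll]
  | cons i prog ih =>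
    refine (ih (i.exec s τ c)).trans ?_
    have := i.exec_time_le s hτ c
    rw [List.length_cons, add_mul]
    omega

theorem execAll_used_subset (s : ℝ) (τ : ℕ) (hprog : ∀ i ∈ prog, i.Direct K) (c : Config)
    (hc : c.used ⊆ Finset.range K) : (execAll s τ prog c).used ⊆ Finset.range K := by
  induction prog generalizing c with
  | nil => exact hc
  | cons i prog ih =>
    exact ih (fun j hj => hprog j (List.mem_cons_of_mem _ hj)) _
      ((hprog i List.mem_cons_self).exec_used s τ hc)

theorem haltsWith_execAll (s : ℝ) (τ : ℕ) (hprog : ∀ i ∈ prog, i.Direct K) (m : ℕ → ℝ) :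
    let c := execAll s τ prog ⟨0, m, 0, ∅⟩
    HaltsWith prog s τ m c.mem c.time c.used := by
  have h := iterate_step_eq_execAll s τ hprog [] ⟨0, m, 0, ∅⟩ rfl
  exact ⟨prog.length, _, h.2.ge, h.1⟩

end StraightLine

/-! ### The program of the monitor -/

section MonitorProgram

/-- Evaluate the score into register `7` and update the counters in registers `0`, `1`, `2`. -/
def counterProgram : List Instr :=
  [.score 7,
    .sub 8 7 1, .mul 8 8 8, .add 8 2 8, .const 9 1, .max 2 9 8,
    .add 0 0 9,
    .sub 10 0 9, .mul 10 10 1, .add 10 10 7, .div 11 9 0, .mul 1 11 10]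

/-- Write `stitch N δ` into register `8`. -/
noncomputable def stitchProgram : List Instr :=
  [.const 8 (Real.exp 1), .mul 8 8 2, .log 8 8, .const 9 Real.pi, .mul 8 9 8,
    .const 9 6, .sqrt 9 9, .div 8 8 9, .log 8 8, .const 9 2, .mul 8 9 8,
    .div 9 9 4, .log 9 9, .add 8 8 9]

/-- Write the end points of the interval into the registers `5` and `6`. -/
noncomputable def intervalProgram : List Instr :=
  [.const 9 2.13, .mul 9 9 2, .mul 9 9 8,
    .const 10 1.76, .mul 11 3 3, .mul 10 10 11, .mul 11 8 8, .mul 10 10 11,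
    .add 9 9 10, .sqrt 9 9, .const 10 1.33, .mul 10 10 3, .mul 10 10 8, .add 9 9 10,
    .div 9 9 0, .sub 5 1 9, .add 6 1 9]

/-- The program of the monitor. -/
noncomputable def monitorProgram : List Instr :=
  counterProgram ++ stitchProgram ++ intervalProgram

theorem monitorProgram_direct : ∀ i ∈ monitorProgram, i.Direct monitorProgram.length := by
  simp [monitorProgram, counterProgram, stitchProgram, intervalProgram, Instr.Direct]

/-- The registers `0, …, 4` hold the counters and the parameters. -/
def Holds (c : Counters) (σ δ : ℝ) (m : ℕ → ℝ) : Prop :=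
  m 0 = c.t ∧ m 1 = c.E ∧ m 2 = c.N ∧ m 3 = σ ∧ m 4 = δ

variable {X : Type*} (ℓ : PMF X → X → ℝ) {c : Counters} {σ δ : ℝ} (τ : ℕ)

theorem holds_counterProgram (p : PMF X × X) (C : Config) (h : Holds c σ δ C.mem) :
    Holds (nextCounters ℓ c p) σ δ (execAll (ℓ p.1 p.2) τ counterProgram C).mem := by
  obtain ⟨h₀, h₁, h₂, h₃, h₄⟩ := h
  simp [Holds, execAll, counterProgram, Instr.exec, Config.write,
    h₀, h₁, h₂, h₃, h₄, nextCounters, sq]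

theorem holds_stitchProgram (s : ℝ) (C : Config) (h : Holds c σ δ C.mem) :
    Holds c σ δ (execAll s τ stitchProgram C).mem ∧
      (execAll s τ stitchProgram C).mem 8 = stitch c.N δ := by
  obtain ⟨h₀, h₁, h₂, h₃, h₄⟩ := h
  simp [Holds, execAll, stitchProgram, Instr.exec, Config.write,
    h₀, h₁, h₂, h₃, h₄, stitch]

theorem holds_intervalProgram (s : ℝ) (C : Config) (h : Holds c σ δ C.mem)
    (h₈ : C.mem 8 = stitch c.N δ) :
    Holds c σ δ (execAll s τ intervalProgram C).mem ∧
      (execAll s τ intervalProgram C).mem 5 = c.E - halfWidth c.t c.N δ σ ∧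
      (execAll s τ intervalProgram C).mem 6 = c.E + halfWidth c.t c.N δ σ := by
  obtain ⟨h₀, h₁, h₂, h₃, h₄⟩ := h
  simp [Holds, execAll, intervalProgram, Instr.exec, Config.write,
    h₀, h₁, h₂, h₃, h₄, h₈, halfWidth, sq]

theorem holds_monitorProgram (p : PMF X × X) (C : Config) (h : Holds c σ δ C.mem) :
    let c' := nextCounters ℓ c p
    let m := (execAll (ℓ p.1 p.2) τ monitorProgram C).mem
    Holds c' σ δ m ∧ m 5 = c'.E - halfWidth c'.t c'.N δ σ ∧
      m 6 = c'.E + halfWidth c'.t c'.N δ σ := by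
  simp only [monitorProgram, execAll_append]
  obtain ⟨h₁, h₂⟩ := holds_stitchProgram τ (ℓ p.1 p.2) _ (holds_counterProgram ℓ τ p C h)
  exact holds_intervalProgram τ _ _ h₁ h₂

theorem implementsMonitor_monitorProgram (a b δ : ℝ) {τ : PMF X → X → ℕ}
    (hτ : ∀ y x, 1 ≤ τ y x) :
    ImplementsMonitor monitorProgram monitorProgram.length ℓ a b δ τ := by
  intro w
  let next : (ℕ → ℝ) → PMF X × X → Config := fun m p =>
    execAll (ℓ p.1 p.2) (τ p.1 p.2) monitorProgram ⟨0, m, 0, ∅⟩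
  let m : ℕ → ℕ → ℝ := fun k =>
    Nat.rec (initRegisters a b δ) (fun k m => (next m (w k)).mem) k
  let c : ℕ → Counters := fun k =>
    (List.ofFn fun i : Fin k => w i).foldl (nextCounters ℓ) initCounters
  have hc : ∀ k, c (k + 1) = nextCounters ℓ (c k) (w k) := by
    intro k
    simp only [c, List.ofFn_succ_last, List.foldl_append]
    rfl
  have hm : ∀ k, Holds (c k) (b - a) δ (m k) := by
    intro k
    induction k with
    | zero => simp [Holds, c, m, initCounters, initRegisters]
    | succ k ih =>
      rw [hc]
      exact (holds_monitorProgram ℓ _ (w k) ⟨0, m k, 0, ∅⟩ ih).1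
  refine ⟨m, rfl, fun k => ⟨⟨_, _, haltsWith_execAll _ _ monitorProgram_direct (m k), ?_, ?_⟩, ?_⟩⟩
  · simpa using execAll_time_le (ℓ (w k).1 (w k).2) (hτ _ _) monitorProgram ⟨0, m k, 0, ∅⟩
  · exact execAll_used_subset _ _ monitorProgram_direct _ (by simp)
  · obtain ⟨⟨h₀, h₁, h₂, -, -⟩, h₅, h₆⟩ :=
      holds_monitorProgram ℓ (τ (w k).1 (w k).2) (w k) ⟨0, m k, 0, ∅⟩ (hm k)
    rw [← hc] at h₀ h₁ h₂ h₅ h₆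
    exact ⟨h₀, h₁, h₂, h₅, h₆⟩

end MonitorProgram

end AlignmentMonitoring

theorem theorem1 :
    ∃ (prog : List AlignmentMonitoring.Instr) (K : ℕ),
      ∀ (X : Type*) [Countable X] [MeasurableSpace X] [DiscreteMeasurableSpace X]
        (ℓ : PMF X → X → ℝ) (a b δ : ℝ),
        (∀ y x, ℓ y x ∈ Set.Icc a b) → 0 < δ → δ < 1 →
          AlignmentMonitoring.SolvesAlignmentProblem
            (AlignmentMonitoring.averageExpectedScore ℓ)
            (AlignmentMonitoring.alignmentMonitor ℓ a b δ) δ ∧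
          AlignmentMonitoring.SolvesAlignmentProblem
            (AlignmentMonitoring.averageExpectedScore ℓ)
            (AlignmentMonitoring.confidenceInterval ℓ a b δ) δ ∧
          ∀ τ : PMF X → X → ℕ, (∀ y x, 1 ≤ τ y x) →
            AlignmentMonitoring.ImplementsMonitor prog K ℓ a b δ τ := by
  refine ⟨AlignmentMonitoring.monitorProgram, AlignmentMonitoring.monitorProgram.length, ?_⟩
  intro X _ _ _ ℓ a b δ hℓ hδ hδ'
  exact ⟨AlignmentMonitoring.solvesAlignmentProblem_alignmentMonitor hℓ hδ hδ',
    AlignmentMonitoring.solvesAlignmentProblem_confidenceInterval hℓ hδ hδ',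
    fun τ hτ => AlignmentMonitoring.implementsMonitor_monitorProgram ℓ a b δ hτ⟩
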